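/- Let $p,n\ge 0$ be integers. Consider probability distributions $P$ of $(X,Y(1),Y(0),T)$ on $\mathbb R^p\times\mathbb R\times\mathbb R\times\{0,1\}$; put $Y=T\,Y(1)+(1-T)\,Y(0)$ and $\Delta=Y(1)-Y(0)$ (the individual treatment effect, ITE). Let $\mathcal E$ be the class of all such $P$ for which the law of at least one coordinate of $X$ is absolutely continuous with respect to Lebesgue measure on $\mathbb R$, and $Y(1)$ and $Y(0)$ are each continuous random variables. Here "continuous" may be read throughout either as "having a continuous distribution function" or as "having a density with respect to Lebesgue measure"; the theorem is asserted under each of the two readings. Let $$\mathcal P_{\mathrm{SI}}=\{P\in\mathcal E:\ (Y(1),Y(0))\perp T\mid X\}$$ be the class of strongly ignorable distributions in $\mathcal E$. Given $P$, let $(X_i,Y_i(1),Y_i(0),T_i)$, $i=1,\dots,n$, and $(X,Y(1),Y(0),T)$ (a new unit) be i.i.d. from $P$. A (possibly randomized) prediction set $\widehat C(x)\subseteq\mathbb R$, $x\in\mathbb R^p$, is constructed from the observed data $\mathcal O_n=\{(X_i,Y_i,T_i)\}_{i=1}^n$ and possibly an auxiliary random seed $S$, with values in some measurable space and a fixed law,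 independent of all units; the indicator $\mathbf 1\{y\in\widehat C(x)\}$ is assumed to be jointly measurable in $(S,\mathcal O_n,x,y)$. Probabilities $\mathbb P_P$ and expectations $\mathbb E_P$ are over the seed, the $n$ units and the new unit. **Theorem (finite-sample impossibility over $\mathcal P_{\mathrm{SI}}$).** Let $\alpha\in(0,1)$ and suppose that $$\sup_{P\in\mathcal P_{\mathrm{SI}}}\mathbb P_P\bigl(\Delta\notin\widehat C(X)\bigr)\le\alpha .$$ Then for every $P\in\mathcal P_{\mathrm{SI}}$ and every $y\in\mathbb R$, $$\mathbb P_P\bigl(y\notin\widehat C(X)\bigr)\le\alpha ,$$ and, for every $P\in\mathcal P_{\mathrm{SI}}$, $$\mathbb E_P\bigl[\mathrm{length}(\widehat C(X))\bigr]=\infty ,$$ where $\mathrm{length}$ denotes Lebesgue measure. -/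

import Mathlib

open MeasureTheory ProbabilityTheory

noncomputable section

namespace ITE

/-- Full data `(X, Y(1), Y(0), T)` of one unit: covariates in `ℝᵖ`, the two potential outcomes,
and the binary treatment (`true` for `T = 1`, `false` for `T = 0`). -/
abbrev FullData (p : ℕ) : Type := (Fin p → ℝ) × ℝ × ℝ × Bool

/-- Observed data `(X, Y, T)` of one unit. -/
abbrev ObsData (p : ℕ) : Type := (Fin p → ℝ) × ℝ × Bool

variable {p : ℕ}

/-- The covariates `X`. -/
def covariates (o : FullData p) : Fin p → ℝ := o.1

/-- The potential outcome `Y(1)`. -/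
def outcome1 (o : FullData p) : ℝ := o.2.1

/-- The potential outcome `Y(0)`. -/
def outcome0 (o : FullData p) : ℝ := o.2.2.1

/-- The treatment indicator `T`. -/
def treatment (o : FullData p) : Bool := o.2.2.2

/-- The observed outcome `Y = T Y(1) + (1 - T) Y(0)`. -/
def observedOutcome (o : FullData p) : ℝ :=
  if treatment o = true then outcome1 o else outcome0 o

/-- The individual treatment effect `Δ = Y(1) - Y(0)`. -/
def effect (o : FullData p) : ℝ := outcome1 o - outcome0 o

/-- The observed part `(X, Y, T)` of the full data. -/
def observe (o : FullData p) : ObsData p := (covariates o, observedOutcome o, treatment o)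

theorem measurable_covariates : Measurable (covariates (p := p)) := measurable_fst

/-- The two usual meanings of "a real random variable is continuous". -/
inductive ContinuityNotion where
  /-- The distribution function is continuous, i.e. the law has no atoms. -/
  | continuousCDF : ContinuityNotion
  /-- The law has a density with respect to Lebesgue measure. -/
  | hasDensity : ContinuityNotion

/-- The law `ν` on the real line is continuous, in the given sense. -/
def ContinuityNotion.Holds : ContinuityNotion → Measure ℝ → Prop
  | .continuousCDF, ν => ∀ x : ℝ, ν {x} = 0
  | .hasDensity, ν => ν ≪ volume

/-- The class `ℰ` of all probability distributions of `(X, Y(1), Y(0), T)` such that at least one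
coordinate of `X` is absolutely continuous with respect to one-dimensional Lebesgue measure, and
each of `Y(1)` and `Y(0)` is continuous (a condition on the two marginal laws). -/
def classE (p : ℕ) (c : ContinuityNotion) : Set (ProbabilityMeasure (FullData p)) :=
  {P | (∃ j : Fin p, (P : Measure (FullData p)).map (fun o => covariates o j) ≪ volume) ∧
    c.Holds ((P : Measure (FullData p)).map outcome1) ∧
    c.Holds ((P : Measure (FullData p)).map outcome0)}

/-- The class of distributions in `ℰ` with `(Y(1), Y(0)) ⊥ T | X` (strong ignorability). -/
def classSI (p : ℕ) (c : ContinuityNotion) : Set (ProbabilityMeasure (FullData p)) :=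
  {P | P ∈ classE p c ∧
    CondIndepFun (MeasurableSpace.comap covariates inferInstance) measurable_covariates.comap_le
      (fun o : FullData p => (outcome1 o, outcome0 o)) treatment (P : Measure (FullData p))}

/-- A (possibly randomized) prediction set built from `n` observed units: the set at covariate
value `x` is `C s d x`, where `d` is the observed data and `s` is the value of an auxiliary random
seed. Membership is jointly measurable. A non-randomized set is the case of a one-point `S`. -/
structure PredictionSet (p n : ℕ) (S : Type*) [MeasurableSpace S] where
  /-- The prediction set. -/
  C : S → (Fin n → ObsData p) → (Fin p → ℝ) → Set ℝ
  /-- The law of the seed, which is independent of the data. -/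
  seedLaw : ProbabilityMeasure S
  measurableSet_mem :
    MeasurableSet {q : S × (Fin n → ObsData p) × (Fin p → ℝ) × ℝ |
      q.2.2.2 ∈ C q.1 q.2.1 q.2.2.1}

namespace PredictionSet

variable {n : ℕ} {S : Type*} [MeasurableSpace S]

/-- The outcomes of the whole experiment: the seed, the full data of the `n` sampled units, and
the full data of the new unit. -/
abbrev Experiment (p n : ℕ) (S : Type*) : Type _ := S × (Fin n → FullData p) × FullData p

/-- The law of the experiment when the `n` units and the new unit are i.i.d. from `P` and the seed
is independent of them. -/
def law (K : PredictionSet p n S) (P : ProbabilityMeasure (FullData p)) :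
    Measure (Experiment p n S) :=
  (K.seedLaw : Measure S).prod
    ((Measure.pi fun _ : Fin n => (P : Measure (FullData p))).prod (P : Measure (FullData p)))

/-- The prediction set `Ĉ(X)` at the covariates of the new unit. -/
def predicted (K : PredictionSet p n S) (ω : Experiment p n S) : Set ℝ :=
  K.C ω.1 (fun i => observe (ω.2.1 i)) (covariates ω.2.2)

/-- The probability `ℙ_P(Δ ∉ Ĉ(X))` of missing the effect of the new unit. -/
def missEffect (K : PredictionSet p n S) (P : ProbabilityMeasure (FullData p)) : ENNReal :=
  K.law P {ω | effect ω.2.2 ∉ K.predicted ω}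

/-- The worst-case miscoverage `sup_{P ∈ 𝒫_SI} ℙ_P(Δ ∉ Ĉ(X))`. -/
def supMissEffect (K : PredictionSet p n S) (c : ContinuityNotion) : ENNReal :=
  ⨆ P ∈ classSI p c, K.missEffect P

/-- The probability `ℙ_P(y ∉ Ĉ(X))` of missing the fixed real number `y`. -/
def missPoint (K : PredictionSet p n S) (P : ProbabilityMeasure (FullData p)) (y : ℝ) : ENNReal :=
  K.law P {ω | y ∉ K.predicted ω}

/-- The expected Lebesgue measure `𝔼_P[length(Ĉ(X))]`. -/
def expectedLength (K : PredictionSet p n S) (P : ProbabilityMeasure (FullData p)) : ENNReal :=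
  ∫⁻ ω, volume (K.predicted ω) ∂(K.law P)

end PredictionSet

end ITE

end

/-! The prediction set sees one potential outcome per unit, so the other can be altered unnoticed.
If the treatment is a function `σ` of the covariates, set the unobserved outcome so that the effect
is identically `y`: the observed law is unchanged, ignorability is trivial, and missing `y` is now
missing the effect. Hence `y` is missed with probability at most the worst-case miscoverage
(`prod_pi_missSet_le`).

For a general ignorable law the treatment is `τ X u` with `u` uniform and independent of covariates
and outcomes (`exists_assignment`). Cut an absolutely continuous coordinate of `X` into cells of
width `1/M` and attach one uniform draw to each cell. With the draws frozen, the treatment is a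
function of `X` and the bound above applies. When the `n` units lie in distinct cells, averaging
over the draws reproduces independent uniforms (`prod_pi_le_lintegral_add`). The collision
probability vanishes as `M` grows (`tendsto_measure_not_injective_floor`), so the bound on missing
`y` holds for every ignorable law. Integrating coverage over `y` makes the expected length infinite.
-/

namespace ITE

/-! ### Altering the unobserved outcome of a unit -/

/-- The covariates and both potential outcomes of a unit, without the treatment. -/
abbrev Unassigned (p : ℕ) : Type := (Fin p → ℝ) × ℝ × ℝ

/-- Forget the treatment. -/
def unassigned {p : ℕ} (o : FullData p) : Unassigned p :=
  (covariates o, outcome1 o, outcome0 o)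

/-- The observed data of a unit that receives the treatment `t`. -/
def observeAt {p : ℕ} (w : Unassigned p) (t : Bool) : ObsData p :=
  (w.1, if t = true then w.2.1 else w.2.2, t)

/-- The unit with treatment `t` and the same observed outcome as `w`, whose unobserved outcome is
changed so that its effect is `y`. -/
def withEffect {p : ℕ} (y : ℝ) (w : Unassigned p) (t : Bool) : FullData p :=
  (w.1, if t = true then w.2.1 else w.2.2 + y, if t = true then w.2.1 - y else w.2.2, t)

variable {p : ℕ}

@[fun_prop]
theorem measurable_covariates_fun : Measurable (covariates (p := p)) := measurable_fst

@[fun_prop]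
theorem measurable_outcome1 : Measurable (outcome1 (p := p)) := by
  unfold outcome1; fun_prop

@[fun_prop]
theorem measurable_outcome0 : Measurable (outcome0 (p := p)) := by
  unfold outcome0; fun_prop

@[fun_prop]
theorem measurable_treatment : Measurable (treatment (p := p)) := by
  unfold treatment; fun_prop

@[fun_prop]
theorem measurable_effect : Measurable (effect (p := p)) := by
  unfold effect; fun_prop

@[fun_prop]
theorem measurable_unassigned : Measurable (unassigned (p := p)) := by
  unfold unassigned; fun_prop

theorem measurable_observeAt : Measurable (fun q : Unassigned p × Bool => observeAt q.1 q.2) := by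
  have h : MeasurableSet {q : Unassigned p × Bool | q.2 = true} :=
    measurable_snd (measurableSet_singleton true)
  unfold observeAt
  exact measurable_fst.fst.prodMk
    ((Measurable.ite h (by fun_prop) (by fun_prop)).prodMk measurable_snd)

theorem measurable_withEffect (y : ℝ) :
    Measurable (fun q : Unassigned p × Bool => withEffect y q.1 q.2) := by
  have h : MeasurableSet {q : Unassigned p × Bool | q.2 = true} :=
    measurable_snd (measurableSet_singleton true)
  unfold withEffect
  exact measurable_fst.fst.prodMk ((Measurable.ite h (by fun_prop) (by fun_prop)).prodMk
    ((Measurable.ite h (by fun_prop) (by fun_prop)).prodMk measurable_snd))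

@[fun_prop]
theorem measurable_observe : Measurable (observe (p := p)) :=
  measurable_observeAt.comp (measurable_unassigned.prodMk measurable_treatment)

theorem observe_withEffect (y : ℝ) (w : Unassigned p) (t : Bool) :
    observe (withEffect y w t) = observeAt w t := by
  cases t <;>
    simp [observe, withEffect, observeAt, covariates, observedOutcome, treatment, outcome1,
      outcome0]

theorem effect_withEffect (y : ℝ) (w : Unassigned p) (t : Bool) :
    effect (withEffect y w t) = y := by
  cases t <;> simp [effect, withEffect, outcome1, outcome0]

/-! ### Ignorable treatment as covariates plus independent noise -/

/-- The law of the covariates and of both potential outcomes. -/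
noncomputable def unassignedLaw (P : ProbabilityMeasure (FullData p)) : Measure (Unassigned p) :=
  (P : Measure (FullData p)).map unassigned

instance (P : ProbabilityMeasure (FullData p)) : IsProbabilityMeasure (unassignedLaw P) :=
  Measure.isProbabilityMeasure_map measurable_unassigned.aemeasurable

theorem unassignedLaw_map_fst (P : ProbabilityMeasure (FullData p)) :
    (unassignedLaw P).map Prod.fst = (P : Measure (FullData p)).map covariates := by
  unfold unassignedLaw
  rw [Measure.map_map (by fun_prop) (by fun_prop)]
  rfl

/-- Under strong ignorability, the treatment is drawn given the covariates by an independent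
uniform random number. -/
theorem exists_assignment {c : ContinuityNotion} {P : ProbabilityMeasure (FullData p)}
    (hP : P ∈ classSI p c) :
    ∃ τ : (Fin p → ℝ) → unitInterval → Bool, Measurable (Function.uncurry τ) ∧
      (P : Measure (FullData p)).map (fun o => (unassigned o, treatment o)) =
        ((unassignedLaw P).prod volume).map (fun q => (q.1, τ q.1.1 q.2)) := by
  -- The conditional law of the treatment given `X` is simulated as an image of the uniform law,
  -- measurably in `X`.
  obtain ⟨τ, hτ, hτκ⟩ := Kernel.exists_measurable_map_eq_unitInterval
    (condDistrib treatment covariates (P : Measure (FullData p)))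
  refine ⟨τ, hτ, ?_⟩
  -- Ignorability: conditioning on the potential outcomes besides `X` does not change the law of the
  -- treatment.
  have h := (condIndepFun_iff_condDistrib_prod_ae_eq_prodMkRight (by fun_prop) (by fun_prop)
    measurable_covariates).1 hP.2
  have h1 : (P : Measure (FullData p)).map (fun o => (unassigned o, treatment o)) =
      unassignedLaw P ⊗ₘ (condDistrib treatment covariates
        (P : Measure (FullData p))).prodMkRight (ℝ × ℝ) := by
    unfold unassignedLaw unassigned
    rw [← Measure.compProd_congr h, compProd_map_condDistrib (by fun_prop)]
  have hm : Measurable (fun q : Unassigned p × unitInterval => (q.1, τ q.1.1 q.2)) :=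
    measurable_fst.prodMk (hτ.comp (measurable_fst.fst.prodMk measurable_snd))
  rw [h1]
  ext A hA
  rw [Measure.compProd_apply hA, Measure.map_apply hm hA, Measure.prod_apply (hm hA)]
  refine lintegral_congr fun w => ?_
  rw [Kernel.prodMkRight_apply, ← hτκ, Measure.map_apply (hτ.of_uncurry_left)
    (measurable_prodMk_left hA)]
  rfl

/-! ### Deterministic treatment with a constant effect -/

/-- The law of units from `P` whose treatment is the function `σ` of the covariates and whose
unobserved outcome is changed so that the effect is `y`. -/
noncomputable def constantEffectLaw (P : ProbabilityMeasure (FullData p)) (y : ℝ)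
    (σ : (Fin p → ℝ) → Bool) : Measure (FullData p) :=
  (unassignedLaw P).map (fun w => withEffect y w (σ w.1))

section constantEffectLaw

variable {P : ProbabilityMeasure (FullData p)} {y : ℝ} {σ : (Fin p → ℝ) → Bool}

theorem measurable_withEffect_comp (y : ℝ) (hσ : Measurable σ) :
    Measurable (fun w : Unassigned p => withEffect y w (σ w.1)) :=
  (measurable_withEffect y).comp (measurable_id.prodMk (hσ.comp measurable_fst))

theorem isProbabilityMeasure_constantEffectLaw (hσ : Measurable σ) :
    IsProbabilityMeasure (constantEffectLaw P y σ) :=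
  Measure.isProbabilityMeasure_map (measurable_withEffect_comp y hσ).aemeasurable

theorem constantEffectLaw_map_covariates (hσ : Measurable σ) :
    (constantEffectLaw P y σ).map covariates = (P : Measure (FullData p)).map covariates := by
  rw [← unassignedLaw_map_fst, constantEffectLaw,
    Measure.map_map (by fun_prop) (measurable_withEffect_comp y hσ)]
  rfl

theorem constantEffectLaw_map_observe (hσ : Measurable σ) :
    (constantEffectLaw P y σ).map observe =
      (unassignedLaw P).map (fun w => observeAt w (σ w.1)) := by
  rw [constantEffectLaw, Measure.map_map (by fun_prop) (measurable_withEffect_comp y hσ)]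
  congr 1
  funext w
  exact observe_withEffect y w _

/-- Whichever arm `σ` selects, `f` depends on a single original outcome, so the event lies in the
union of two null events. The dependence between `σ` and the outcomes plays no role. -/
theorem constantEffectLaw_null_of_null (hσ : Measurable σ) {f : FullData p → ℝ}
    {N : Set ℝ} (hf : Measurable f) (hN : MeasurableSet N) {g₁ g₂ : ℝ → ℝ}
    (hfg : ∀ w t, f (withEffect y w t) = g₁ w.2.1 ∨ f (withEffect y w t) = g₂ w.2.2)
    (h1 : (P : Measure (FullData p)) (outcome1 ⁻¹' (g₁ ⁻¹' N)) = 0)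
    (h0 : (P : Measure (FullData p)) (outcome0 ⁻¹' (g₂ ⁻¹' N)) = 0) :
    (constantEffectLaw P y σ).map f N = 0 := by
  have hm := measurable_withEffect_comp (p := p) y hσ
  rw [Measure.map_apply hf hN, constantEffectLaw, Measure.map_apply hm (hf hN), unassignedLaw,
    Measure.map_apply measurable_unassigned (hm (hf hN))]
  refine measure_mono_null (fun o ho => ?_) (measure_union_null h1 h0)
  simp only [Set.mem_preimage] at ho
  rcases hfg (unassigned o) (σ (unassigned o).1) with h | h <;> rw [h] at ho
  · exact Or.inl ho
  · exact Or.inr ho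

theorem ContinuityNotion.holds_constantEffectLaw (c : ContinuityNotion) (hσ : Measurable σ)
    {f : FullData p → ℝ} (hf : Measurable f) (a b : ℝ)
    (hfg : ∀ w t, f (withEffect y w t) = w.2.1 + a ∨ f (withEffect y w t) = w.2.2 + b)
    (h1 : c.Holds ((P : Measure (FullData p)).map outcome1))
    (h0 : c.Holds ((P : Measure (FullData p)).map outcome0)) :
    c.Holds ((constantEffectLaw P y σ).map f) := by
  cases c with
  | continuousCDF =>
    intro x
    refine constantEffectLaw_null_of_null hσ hf (measurableSet_singleton x) (g₁ := (· + a))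
      (g₂ := (· + b)) hfg ?_ ?_
    · have := h1 (x - a)
      rw [Measure.map_apply (by fun_prop) (measurableSet_singleton _)] at this
      convert this using 3
      ext z; simp only [Set.mem_preimage, Set.mem_singleton_iff, eq_sub_iff_add_eq]
    · have := h0 (x - b)
      rw [Measure.map_apply (by fun_prop) (measurableSet_singleton _)] at this
      convert this using 3
      ext z; simp only [Set.mem_preimage, Set.mem_singleton_iff, eq_sub_iff_add_eq]
  | hasDensity =>
    refine Measure.AbsolutelyContinuous.mk fun N hN hN0 => ?_
    refine constantEffectLaw_null_of_null hσ hf hN (g₁ := (· + a)) (g₂ := (· + b)) hfg ?_ ?_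
    · rw [← Measure.map_apply (by fun_prop) (hN.preimage (measurable_add_const a))]
      exact h1 (by simpa using hN0)
    · rw [← Measure.map_apply (by fun_prop) (hN.preimage (measurable_add_const b))]
      exact h0 (by simpa using hN0)

/-- A treatment determined by the covariates is conditionally independent of anything given them.
The identity with `σ ∘ covariates` holds only almost surely, so the proof passes through joint laws,
which ignore null sets. -/
theorem condIndepFun_treatment_constantEffectLaw (hσ : Measurable σ)
    [IsFiniteMeasure (constantEffectLaw P y σ)] :
    CondIndepFun (MeasurableSpace.comap covariates inferInstance) measurable_covariates.comap_le
      (fun o : FullData p => (outcome1 o, outcome0 o)) treatment (constantEffectLaw P y σ) := by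
  rw [condIndepFun_iff_map_prod_eq_prod_condDistrib_prod_condDistrib (by fun_prop)
    (by fun_prop) measurable_covariates]
  have hae : treatment =ᵐ[constantEffectLaw P y σ] σ ∘ covariates := by
    rw [Filter.EventuallyEq, constantEffectLaw,
      ae_map_iff (measurable_withEffect_comp y hσ).aemeasurable
        (measurableSet_eq_fun (by fun_prop) (hσ.comp measurable_covariates))]
    exact ae_of_all _ fun w => rfl
  rw [condDistrib_congr_left hae, Measure.map_congr (g := fun o : FullData p =>
    (covariates o, (outcome1 o, outcome0 o), (σ ∘ covariates) o)) (by
      filter_upwards [hae] with o ho; rw [ho])]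
  rw [← condIndepFun_iff_map_prod_eq_prod_condDistrib_prod_condDistrib (by fun_prop)
    (hσ.comp measurable_covariates) measurable_covariates]
  exact condIndepFun_of_measurable_right (by fun_prop) (hσ.comp (comap_measurable _))

theorem constantEffectLaw_mem_classSI {c : ContinuityNotion} (hP : P ∈ classE p c)
    (hσ : Measurable σ) :
    (⟨constantEffectLaw P y σ, isProbabilityMeasure_constantEffectLaw hσ⟩ :
      ProbabilityMeasure (FullData p)) ∈ classSI p c := by
  have := isProbabilityMeasure_constantEffectLaw (P := P) (y := y) hσ
  obtain ⟨⟨j, hj⟩, h1, h0⟩ := hP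
  refine ⟨⟨⟨j, ?_⟩, ?_, ?_⟩, condIndepFun_treatment_constantEffectLaw hσ⟩
  · have key : ∀ μ : Measure (FullData p),
        μ.map (fun o => covariates o j) = (μ.map covariates).map (fun x => x j) := fun μ => by
      rw [Measure.map_map (by fun_prop) (by fun_prop)]; rfl
    rw [key] at hj ⊢
    exact (constantEffectLaw_map_covariates hσ).symm ▸ hj
  · refine c.holds_constantEffectLaw hσ measurable_outcome1 0 y (fun w t => ?_) h1 h0
    cases t <;> simp [withEffect, outcome1]
  · refine c.holds_constantEffectLaw hσ measurable_outcome0 (-y) 0 (fun w t => ?_) h1 h0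
    cases t <;> simp [withEffect, outcome0, sub_eq_add_neg]

end constantEffectLaw

/-! ### Averaging over a random function of a discrete label -/

section Averaging

open Filter Topology

variable {W V O Z : Type*} [MeasurableSpace W] [MeasurableSpace V] [MeasurableSpace O]
  [MeasurableSpace Z]

/-- Restricting independent draws to finitely many distinct indices gives independent draws. -/
theorem infinitePi_map_injective {ι κ : Type*} [Fintype ι] (ν : Measure V)
    [IsProbabilityMeasure ν] {f : ι → κ} (hf : Function.Injective f) :
    (Measure.infinitePi fun _ : κ => ν).map (fun U i => U (f i)) = Measure.pi fun _ : ι => ν := by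
  rw [Measure.map_infinitePi_infinitePi_of_inj (P := fun _ : κ => ν) hf,
    Measure.infinitePi_eq_pi]

theorem measurable_eval_label {b : W → ℤ} (hb : Measurable b) :
    Measurable (fun q : W × (ℤ → V) => q.2 (b q.1)) := by
  have h : Measurable (fun q : ℤ × (ℤ → V) => q.2 q.1) :=
    measurable_from_prod_countable_right fun k => measurable_pi_apply k
  exact h.comp ((hb.comp measurable_fst).prodMk measurable_snd)

theorem measurableSet_not_injective {n : ℕ} {b : W → ℤ} (hb : Measurable b) :
    MeasurableSet {w : Fin n → W | ¬ Function.Injective fun i => b (w i)} := by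
  have h : Measurable fun (w : Fin n → W) (i : Fin n) => b (w i) := by fun_prop
  exact h (MeasurableSet.of_discrete (s := {k : Fin n → ℤ | ¬ Function.Injective k}))

theorem pi_map_prod {n : ℕ} (ν : Measure W) [IsProbabilityMeasure ν] (θ : Measure V)
    [IsProbabilityMeasure θ] {G : W × V → O} (hG : Measurable G) :
    (Measure.pi fun _ : Fin n => (ν.prod θ).map G) =
      ((Measure.pi fun _ : Fin n => ν).prod (Measure.pi fun _ : Fin n => θ)).map
        (fun q i => G (q.1 i, q.2 i)) := by
  have := Measure.isProbabilityMeasure_map (μ := ν.prod θ) hG.aemeasurable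
  have h := (measurePreserving_arrowProdEquivProdArrow W V (Fin n) (fun _ => ν)
    (fun _ => θ)).map_eq
  rw [← h, Measure.map_map (by fun_prop) (MeasurableEquiv.measurable _),
    ← Measure.pi_map_pi (fun _ => hG.aemeasurable)]
  rfl

/-- Independent draws from the law of `G (w, v)` are dominated, up to the probability that two
labels coincide, by a mixture of laws under which `v` is a function of the label of `w`. -/
theorem prod_pi_le_lintegral_add {n : ℕ} (ρ : Measure Z) [IsProbabilityMeasure ρ]
    (ν : Measure W) [IsProbabilityMeasure ν] (θ : Measure V) [IsProbabilityMeasure θ]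
    {G : W × V → O} (hG : Measurable G) {b : W → ℤ} (hb : Measurable b)
    {A : Set (Z × (Fin n → O))} (hA : MeasurableSet A) :
    (ρ.prod (Measure.pi fun _ : Fin n => (ν.prod θ).map G)) A ≤
      (∫⁻ U, (ρ.prod (Measure.pi fun _ : Fin n => ν.map fun w => G (w, U (b w)))) A
        ∂(Measure.infinitePi fun _ : ℤ => θ)) +
      (Measure.pi fun _ : Fin n => ν) {w | ¬ Function.Injective fun i => b (w i)} := by
  set Λ : Measure (ℤ → V) := Measure.infinitePi fun _ : ℤ => θ with hΛ
  set π : Measure (Fin n → W) := Measure.pi fun _ : Fin n => ν with hπ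
  set E : Set (Fin n → W) := {w | ¬ Function.Injective fun i => b (w i)} with hE
  have hEm : MeasurableSet E := measurableSet_not_injective hb
  have hlab : ∀ i : Fin n,
      Measurable (fun q : (Z × (Fin n → W)) × (ℤ → V) => q.2 (b (q.1.2 i))) := fun i =>
    Measurable.comp (g := fun q : W × (ℤ → V) => q.2 (b q.1))
      (f := fun q : (Z × (Fin n → W)) × (ℤ → V) => (q.1.2 i, q.2)) (measurable_eval_label hb)
      (((measurable_pi_apply i).comp measurable_fst.snd).prodMk measurable_snd)
  have hΦ : Measurable (fun q : (Z × (Fin n → W)) × (Fin n → V) =>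
      (q.1.1, fun i => G (q.1.2 i, q.2 i))) := by fun_prop
  have hΨ : Measurable (fun q : (Z × (Fin n → W)) × (ℤ → V) =>
      (q.1.1, fun i => G (q.1.2 i, q.2 (b (q.1.2 i))))) := by fun_prop
  have hleft : (ρ.prod (Measure.pi fun _ : Fin n => (ν.prod θ).map G)) A =
      ∫⁻ q, (Measure.pi fun _ : Fin n => θ) {v | (q.1, fun i => G (q.2 i, v i)) ∈ A}
        ∂(ρ.prod π) := by
    have hassoc := (measurePreserving_prodAssoc ρ π (Measure.pi fun _ : Fin n => θ)).map_eq
    have hmap : (ρ.prod (Measure.pi fun _ : Fin n => (ν.prod θ).map G)) =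
        ((ρ.prod π).prod (Measure.pi fun _ : Fin n => θ)).map
          (fun q => (q.1.1, fun i => G (q.1.2 i, q.2 i))) := by
      rw [pi_map_prod ν θ hG, ← Measure.map_id (μ := ρ), Measure.map_prod_map _ _ measurable_id
        (by fun_prop), Measure.map_id, ← hassoc,
        Measure.map_map (by fun_prop) (MeasurableEquiv.measurable _)]
      rfl
    rw [hmap, Measure.map_apply hΦ hA, Measure.prod_apply (hΦ hA)]
    rfl
  have hright : ∀ U : ℤ → V,
      (ρ.prod (Measure.pi fun _ : Fin n => ν.map fun w => G (w, U (b w)))) A =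
        (ρ.prod π) {q | (q.1, fun i => G (q.2 i, U (b (q.2 i)))) ∈ A} := fun U => by
    have hU : Measurable fun w => G (w, U (b w)) :=
      hG.comp (measurable_id.prodMk ((measurable_eval_label hb).comp
        (measurable_id.prodMk measurable_const)))
    have := Measure.isProbabilityMeasure_map (μ := ν) hU.aemeasurable
    have hpi : Measurable fun (w : Fin n → W) (i : Fin n) => G (w i, U (b (w i))) :=
      measurable_pi_lambda _ fun i => hU.comp (measurable_pi_apply i)
    rw [← Measure.pi_map_pi (fun _ => hU.aemeasurable), ← Measure.map_id (μ := ρ),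
      Measure.map_prod_map _ _ measurable_id hpi, Measure.map_id,
      Measure.map_apply (by fun_prop) hA]
    rfl
  -- With the units fixed and their labels distinct, the draws read off at those labels are again
  -- i.i.d. from `θ`; otherwise the indicator supplies the trivial bound `1`.
  have hpoint : ∀ q : Z × (Fin n → W),
      (Measure.pi fun _ : Fin n => θ) {v | (q.1, fun i => G (q.2 i, v i)) ∈ A} ≤
        Λ {U | (q.1, fun i => G (q.2 i, U (b (q.2 i)))) ∈ A} +
          (Set.univ ×ˢ E).indicator 1 q := fun q => by
    by_cases hq : q.2 ∈ E
    · rw [Set.indicator_of_mem (by simpa using hq)]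
      exact prob_le_one.trans le_add_self
    · refine le_add_right (le_of_eq ?_)
      have hinj : Function.Injective fun i => b (q.2 i) := not_not.1 hq
      have hm : MeasurableSet {v : Fin n → V | (q.1, fun i => G (q.2 i, v i)) ∈ A} :=
        (hΦ.comp measurable_prodMk_left) hA
      rw [← infinitePi_map_injective θ hinj, Measure.map_apply (by fun_prop) hm]
      rfl
  calc (ρ.prod (Measure.pi fun _ : Fin n => (ν.prod θ).map G)) A
      ≤ ∫⁻ q, (Λ {U | (q.1, fun i => G (q.2 i, U (b (q.2 i)))) ∈ A} +
          (Set.univ ×ˢ E).indicator 1 q) ∂(ρ.prod π) := hleft.trans_le (lintegral_mono hpoint)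
    _ = (∫⁻ q, Λ {U | (q.1, fun i => G (q.2 i, U (b (q.2 i)))) ∈ A} ∂(ρ.prod π)) + π E := by
        have hm : MeasurableSet ((Set.univ : Set Z) ×ˢ E) := MeasurableSet.univ.prod hEm
        rw [lintegral_add_right _ (measurable_one.indicator hm), lintegral_indicator_one hm,
          Measure.prod_prod, measure_univ, one_mul]
    _ = ((ρ.prod π).prod Λ) ((fun q : (Z × (Fin n → W)) × (ℤ → V) =>
          (q.1.1, fun i => G (q.1.2 i, q.2 (b (q.1.2 i))))) ⁻¹' A) + π E := by
        rw [Measure.prod_apply (hΨ hA)]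
        rfl
    _ = _ := by
        rw [Measure.prod_apply_symm (hΨ hA)]
        congr 1
        exact lintegral_congr fun U => (hright U).symm

/-- Under an atomless law of a real feature, finitely many independent draws almost surely fall
into distinct cells of a grid, as the mesh tends to zero. -/
theorem tendsto_measure_not_injective_floor (n : ℕ) (ν : Measure W) [IsProbabilityMeasure ν]
    {f : W → ℝ} (hf : Measurable f) [NullSingletonClass (ν.map f)] :
    Tendsto (fun M : ℕ => (Measure.pi fun _ : Fin n => ν)
      {w | ¬ Function.Injective fun i => ⌊(M : ℝ) * f (w i)⌋}) atTop (𝓝 0) := by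
  have hfi : ∀ i : Fin n, Measurable fun w : Fin n → W => f (w i) := fun i => by fun_prop
  have hne : ∀ i k : Fin n, i ≠ k →
      ∀ᵐ w ∂(Measure.pi fun _ : Fin n => ν), f (w i) ≠ f (w k) := fun i k hik => by
    have hind : IndepFun (fun w : Fin n → W => f (w i)) (fun w => f (w k))
        (Measure.pi fun _ : Fin n => ν) :=
      (iIndepFun_pi (μ := fun _ : Fin n => ν) (X := fun _ => f) fun _ => hf.aemeasurable).indepFun
        hik
    rw [indepFun_iff_map_prod_eq_prod_map_map (hfi i).aemeasurable (hfi k).aemeasurable] at hind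
    have hev : ∀ i : Fin n, (Measure.pi fun _ : Fin n => ν).map (fun w => f (w i)) = ν.map f :=
      fun i => by
        conv_rhs => rw [← (measurePreserving_eval (fun _ : Fin n => ν) i).map_eq,
          Measure.map_map hf (measurable_pi_apply i)]
        rfl
    rw [hev, hev] at hind
    have := Measure.isProbabilityMeasure_map (μ := ν) hf.aemeasurable
    have hdiag : ((ν.map f).prod (ν.map f)) (Set.diagonal ℝ) = 0 := by
      rw [Measure.prod_apply measurableSet_diagonal]
      refine (lintegral_congr fun x => ?_).trans lintegral_zero
      rw [show Prod.mk x ⁻¹' Set.diagonal ℝ = {x} by ext z; simp [eq_comm]]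
      exact measure_singleton x
    rw [← hind, Measure.map_apply (by fun_prop) measurableSet_diagonal] at hdiag
    exact measure_eq_zero_iff_ae_notMem.1 hdiag
  have hinj : ∀ᵐ w ∂(Measure.pi fun _ : Fin n => ν), ∀ i k : Fin n, i ≠ k → f (w i) ≠ f (w k) := by
    simp only [ae_all_iff]
    exact hne
  rw [← measure_empty (μ := Measure.pi fun _ : Fin n => ν)]
  refine tendsto_measure_of_ae_tendsto_indicator_of_isFiniteMeasure atTop MeasurableSet.empty
    (fun M => measurableSet_not_injective (b := fun w => ⌊(M : ℝ) * f w⌋) (by fun_prop)) ?_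
  filter_upwards [hinj] with w hw
  have : ∀ i k : Fin n, i ≠ k →
      ∀ᶠ M : ℕ in atTop, ⌊(M : ℝ) * f (w i)⌋ ≠ ⌊(M : ℝ) * f (w k)⌋ := fun i k hik => by
    -- Equal floors force `M * |f (w i) - f (w k)| < 1`, which fails for large `M`.
    have hpos : 0 < |f (w i) - f (w k)| := abs_pos.2 (sub_ne_zero.2 (hw i k hik))
    filter_upwards [(tendsto_natCast_atTop_atTop.atTop_mul_const hpos).eventually_ge_atTop 1]
      with M hM heq
    have := Int.abs_sub_lt_one_of_floor_eq_floor heq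
    rw [← mul_sub, abs_mul, Nat.abs_cast] at this
    exact absurd hM (not_le.2 this)
  filter_upwards [eventually_all.2 fun i => eventually_all.2 fun k => eventually_imp_distrib_left.2
    (this i k)] with M hM
  simp only [Set.mem_empty_iff_false, iff_false, not_not]
  intro i k hik
  by_contra h
  exact hM i k h hik

end Averaging

/-! ### Transfer to miscoverage of a fixed point -/

namespace PredictionSet

open Filter Topology

variable {p n : ℕ} {S : Type*} [MeasurableSpace S]

/-- The law of the seed and of the covariates of the new unit. -/
noncomputable def queryLaw (K : PredictionSet p n S) (P : ProbabilityMeasure (FullData p)) :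
    Measure (S × (Fin p → ℝ)) :=
  (K.seedLaw : Measure S).prod ((P : Measure (FullData p)).map covariates)

instance (K : PredictionSet p n S) (P : ProbabilityMeasure (FullData p)) :
    IsProbabilityMeasure (K.queryLaw P) := by
  have := Measure.isProbabilityMeasure_map (μ := (P : Measure (FullData p)))
    measurable_covariates.aemeasurable
  unfold queryLaw
  infer_instance

instance (K : PredictionSet p n S) (P : ProbabilityMeasure (FullData p)) :
    IsProbabilityMeasure (K.law P) := by
  unfold law
  infer_instance

/-- The part of an experiment that determines the predicted set. -/
def inputs (ω : Experiment p n S) : (S × (Fin p → ℝ)) × (Fin n → ObsData p) :=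
  ((ω.1, covariates ω.2.2), fun i => observe (ω.2.1 i))

theorem measurable_inputs : Measurable (inputs (p := p) (n := n) (S := S)) := by
  unfold inputs
  fun_prop

/-- Only the covariates of the new unit enter, so the law of the predicted set depends on `P` solely
through its covariate law and its observed law, both of which survive a change of the unobserved
outcome. -/
theorem law_map_inputs (K : PredictionSet p n S) (P : ProbabilityMeasure (FullData p)) :
    (K.law P).map inputs = (K.queryLaw P).prod
      (Measure.pi fun _ : Fin n => (P : Measure (FullData p)).map observe) := by
  have := Measure.isProbabilityMeasure_map (μ := (P : Measure (FullData p)))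
    measurable_covariates.aemeasurable
  have := Measure.isProbabilityMeasure_map (μ := (P : Measure (FullData p)))
    measurable_observe.aemeasurable
  set D := Measure.pi fun _ : Fin n => (P : Measure (FullData p)) with hD
  have hobs : Measurable fun (d : Fin n → FullData p) (i : Fin n) => observe (d i) := by fun_prop
  rw [← Measure.pi_map_pi (fun _ => measurable_observe.aemeasurable), queryLaw, ← hD,
    ← (measurePreserving_prodAssoc (K.seedLaw : Measure S) _ _).symm.map_eq,
    ← Measure.prod_swap (μ := D.map _), Measure.map_prod_map _ _ hobs measurable_covariates]
  conv_rhs => rw [← Measure.map_id (μ := (K.seedLaw : Measure S))]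
  rw [Measure.map_map measurable_swap (by fun_prop),
    Measure.map_prod_map _ _ measurable_id (by fun_prop),
    Measure.map_map (MeasurableEquiv.measurable _) (by fun_prop)]
  rfl

/-- The inputs for which the predicted set misses `y`. -/
def missSet (K : PredictionSet p n S) (y : ℝ) : Set ((S × (Fin p → ℝ)) × (Fin n → ObsData p)) :=
  {q | y ∉ K.C q.1.1 q.2 q.1.2}

theorem measurableSet_missSet (K : PredictionSet p n S) (y : ℝ) :
    MeasurableSet (K.missSet y) := by
  have h : Measurable fun q : (S × (Fin p → ℝ)) × (Fin n → ObsData p) =>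
      (q.1.1, q.2, q.1.2, y) := by fun_prop
  exact (h K.measurableSet_mem).compl

theorem missPoint_eq (K : PredictionSet p n S) (P : ProbabilityMeasure (FullData p)) (y : ℝ) :
    K.missPoint P y = (K.queryLaw P).prod
      (Measure.pi fun _ : Fin n => (P : Measure (FullData p)).map observe) (K.missSet y) := by
  rw [← law_map_inputs, Measure.map_apply measurable_inputs (K.measurableSet_missSet y)]
  rfl

/-- When the effect is almost surely `y`, missing `y` is missing the effect. -/
theorem missPoint_eq_missEffect (K : PredictionSet p n S) {P : ProbabilityMeasure (FullData p)}
    {y : ℝ} (h : ∀ᵐ o ∂(P : Measure (FullData p)), effect o = y) :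
    K.missPoint P y = K.missEffect P := by
  have h1 : ∀ᵐ ω ∂(K.law P), effect ω.2.2 = y :=
    (Measure.quasiMeasurePreserving_snd.comp Measure.quasiMeasurePreserving_snd).ae h
  refine measure_congr ?_
  filter_upwards [h1] with ω hω
  exact congrArg (fun z => z ∉ K.predicted ω) hω.symm

/-- The supremum of the miscoverage bounds the probability of missing `y` when the treatment is a
function of the covariates and the effect is constantly `y`. -/
theorem prod_pi_missSet_le (K : PredictionSet p n S) {c : ContinuityNotion}
    {P : ProbabilityMeasure (FullData p)} (hP : P ∈ classE p c) (y : ℝ)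
    {σ : (Fin p → ℝ) → Bool} (hσ : Measurable σ) :
    (K.queryLaw P).prod (Measure.pi fun _ : Fin n =>
      (unassignedLaw P).map fun w => observeAt w (σ w.1)) (K.missSet y) ≤ K.supMissEffect c := by
  let Q : ProbabilityMeasure (FullData p) :=
    ⟨constantEffectLaw P y σ, isProbabilityMeasure_constantEffectLaw hσ⟩
  have hQ : Q ∈ classSI p c := constantEffectLaw_mem_classSI hP hσ
  have hq : K.queryLaw Q = K.queryLaw P := by
    unfold queryLaw
    exact congrArg _ (constantEffectLaw_map_covariates hσ)
  have heff : ∀ᵐ o ∂(Q : Measure (FullData p)), effect o = y := by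
    change ∀ᵐ o ∂(constantEffectLaw P y σ), effect o = y
    rw [constantEffectLaw, ae_map_iff (measurable_withEffect_comp y hσ).aemeasurable
      (measurableSet_eq_fun measurable_effect measurable_const)]
    exact ae_of_all _ fun w => effect_withEffect y w _
  have h := K.missPoint_eq Q y
  rw [hq, show (Q : Measure (FullData p)).map observe = _ from constantEffectLaw_map_observe hσ,
    K.missPoint_eq_missEffect heff] at h
  rw [← h]
  exact le_iSup₂ (f := fun P (_ : P ∈ classSI p c) => K.missEffect P) Q hQ

theorem missPoint_le_supMissEffect (K : PredictionSet p n S) {c : ContinuityNotion}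
    {P : ProbabilityMeasure (FullData p)} (hP : P ∈ classSI p c) (y : ℝ) :
    K.missPoint P y ≤ K.supMissEffect c := by
  obtain ⟨τ, hτ, hlaw⟩ := exists_assignment hP
  obtain ⟨j, hj⟩ := hP.1.1
  have hf : Measurable fun w : Unassigned p => w.1 j := by fun_prop
  have hτ' : Measurable fun q : Unassigned p × unitInterval => (q.1, τ q.1.1 q.2) :=
    measurable_fst.prodMk (hτ.comp (measurable_fst.fst.prodMk measurable_snd))
  have hG : Measurable fun q : Unassigned p × unitInterval => observeAt q.1 (τ q.1.1 q.2) :=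
    measurable_observeAt.comp hτ'
  have hobs : (P : Measure (FullData p)).map observe =
      ((unassignedLaw P).prod volume).map fun q => observeAt q.1 (τ q.1.1 q.2) := by
    have h := congrArg (Measure.map fun q : Unassigned p × Bool => observeAt q.1 q.2) hlaw
    rwa [Measure.map_map measurable_observeAt hτ',
      Measure.map_map measurable_observeAt (by fun_prop)] at h
  have : NullSingletonClass ((unassignedLaw P).map fun w => w.1 j) := by
    refine ⟨fun x => ?_⟩
    rw [unassignedLaw, Measure.map_map hf measurable_unassigned]
    exact hj (measure_singleton x)
  have hlim := (tendsto_measure_not_injective_floor n (unassignedLaw P) hf).const_add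
    (K.supMissEffect c)
  rw [add_zero] at hlim
  -- It suffices to bound, for each `M`, by the supremum plus the collision probability.
  refine ge_of_tendsto' hlim fun M => ?_
  have hb : Measurable fun w : Unassigned p => ⌊(M : ℝ) * w.1 j⌋ := by fun_prop
  rw [missPoint_eq, hobs]
  refine (prod_pi_le_lintegral_add (K.queryLaw P) (unassignedLaw P) volume hG hb
    (K.measurableSet_missSet y)).trans (add_le_add_left ?_ _)
  refine (lintegral_mono fun U => ?_).trans_eq
    ((lintegral_const (K.supMissEffect c)).trans (by rw [measure_univ, mul_one]))
  -- For frozen cell draws `U`, this treatment rule depends on the covariates alone.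
  have hσ : Measurable fun x : Fin p → ℝ => τ x (U ⌊(M : ℝ) * x j⌋) :=
    hτ.comp (measurable_id.prodMk ((measurable_from_top (f := U)).comp (by fun_prop)))
  exact K.prod_pi_missSet_le hP.1 y hσ

/-! ### Expected length by Tonelli -/

theorem measurableSet_mem_predicted (K : PredictionSet p n S) :
    MeasurableSet {q : Experiment p n S × ℝ | q.2 ∈ K.predicted q.1} := by
  have h : Measurable fun q : Experiment p n S × ℝ =>
      (q.1.1, (fun i => observe (q.1.2.1 i)), covariates q.1.2.2, q.2) := by fun_prop
  exact h K.measurableSet_mem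

/-- The expected length is the integral of the coverage probabilities of the real numbers. -/
theorem expectedLength_eq_lintegral (K : PredictionSet p n S)
    (P : ProbabilityMeasure (FullData p)) :
    K.expectedLength P = ∫⁻ y, (1 - K.missPoint P y) := by
  have h := K.measurableSet_mem_predicted
  have h1 := Measure.prod_apply (μ := K.law P) (ν := (volume : Measure ℝ)) h
  rw [Measure.prod_apply_symm h] at h1
  refine h1.symm.trans (lintegral_congr fun y => ?_)
  have hy : MeasurableSet {ω : Experiment p n S | y ∈ K.predicted ω} := measurable_prodMk_right h
  have h2 := prob_compl_eq_one_sub (μ := K.law P) hy.compl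
  rw [compl_compl] at h2
  exact h2

end PredictionSet

end ITE

theorem mainTheorem7 {p n : ℕ} {S : Type*} [MeasurableSpace S] (c : ITE.ContinuityNotion)
    (K : ITE.PredictionSet p n S) (α : ℝ) (hα : α ∈ Set.Ioo (0 : ℝ) 1)
    (hcov : K.supMissEffect c ≤ ENNReal.ofReal α) :
    ∀ P ∈ ITE.classSI p c,
      (∀ y : ℝ, K.missPoint P y ≤ ENNReal.ofReal α) ∧ K.expectedLength P = ⊤ := by
  intro P hP
  have hmiss : ∀ y : ℝ, K.missPoint P y ≤ ENNReal.ofReal α := fun y =>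
    (K.missPoint_le_supMissEffect hP y).trans hcov
  refine ⟨hmiss, ?_⟩
  have hpos : 1 - ENNReal.ofReal α ≠ 0 := by
    rw [← ENNReal.ofReal_one, ← ENNReal.ofReal_sub _ hα.1.le]
    exact (ENNReal.ofReal_pos.2 (sub_pos.2 hα.2)).ne'
  rw [K.expectedLength_eq_lintegral, eq_top_iff]
  -- Every real number is covered with probability at least `1 - α > 0`, and the line has infinite
  -- length.
  calc (⊤ : ENNReal) = ∫⁻ _ : ℝ, (1 - ENNReal.ofReal α) := by
        rw [lintegral_const, Real.volume_univ, ENNReal.mul_top hpos]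
    _ ≤ ∫⁻ y, (1 - K.missPoint P y) := lintegral_mono fun y => tsub_le_tsub_left (hmiss y) 1
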